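/- Call a sequence of rationals recursive if its signs, numerators and (nonzero) denominators are given by total recursive functions (likewise for double sequences). A real $x$ is recursive if there is a recursive sequence of rationals $(q_k)_{k\in\mathbb N}$ with $|q_k-x|\le 2^{-k}$ for all $k$. A function $p\colon\mathbb N\to\mathbb R$ (a sequence of reals) is recursive if there is a recursive double sequence of rationals $(q_{n,k})$ with $|q_{n,k}-p(n)|\le 2^{-k}$ for all $n,k$. A function $f\colon[0,\infty)\to\mathbb R$ is recursive if (i) for every recursive sequence $(x_n)$ of reals in $[0,\infty)$ the sequence $(f(x_n))$ is recursive, and (ii) there is a recursive $d\colon\mathbb N^2\to\mathbb N$ such that for all $M,N\in\mathbb N$ and $x,y\in[0,M]$, $|x-y|\le 2^{-d(M,N)}$ implies $|f(x)-f(y)|\le 2^{-N}$. An order function is a recursive, nondecreasing, unbounded function from $\mathbb N$ to $\mathbb R$. **Proposition.** Let $p\colon\mathbb N\to(0,\infty)$ be an order function which is fast-growing, i.e. $\sum_{n=0}^\infty p(n)^{-1}<\infty$, and let $\overline p\colon[0,\infty)\to(0,\infty)$ be any continuous, recursive, nondecreasing function with $\overline p(n)=p(n)$ for all $n\in\mathbb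 N$. Then $\int_0^\infty\overline p(x)^{-1}\,dx$ converges, and $\sum_{n=0}^\infty p(n)^{-1}$ is a recursive real if and only if $\int_0^\infty\overline p(x)^{-1}\,dx$ is a recursive real. -/

import Mathlib

open Set Filter MeasureTheory

/-- A family of rationals indexed by a coded type is recursive if sign, numerator and
denominator can be given by total recursive functions. -/
def IsRecursiveRat {α : Type} [Primcodable α] (q : α → ℚ) : Prop :=
  ∃ s a b : α → ℕ, Computable s ∧ Computable a ∧ Computable b ∧
    ∀ i, b i ≠ 0 ∧ q i = (-1) ^ s i * (a i : ℚ) / (b i : ℚ)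

/-- A recursive real: it is the limit of a recursive sequence of rationals with error
at most `2⁻ᵏ` at stage `k`. -/
def IsRecursiveReal (x : ℝ) : Prop :=
  ∃ q : ℕ → ℚ, IsRecursiveRat q ∧ ∀ k : ℕ, |(q k : ℝ) - x| ≤ (1 / 2) ^ k

/-- A recursive (computable) function `ℕ → ℝ`, i.e. a sequence of uniformly recursive reals. -/
def IsRecursiveSeq (x : ℕ → ℝ) : Prop :=
  ∃ q : ℕ × ℕ → ℚ, IsRecursiveRat q ∧ ∀ n k : ℕ, |(q (n, k) : ℝ) - x n| ≤ (1 / 2) ^ k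

/-- A recursive real function on `[0, ∞)` (Grzegorczyk; Pour-El and Richards): it sends
sequences of uniformly recursive reals to sequences of uniformly recursive reals, and on the
intervals `[0, M]` it is uniformly continuous with a modulus that is recursive in `M` and in
the precision. Values of `f` outside `[0, ∞)` play no role. -/
structure IsRecursiveFunOnNonneg (f : ℝ → ℝ) : Prop where
  seq : ∀ x : ℕ → ℝ, (∀ n, 0 ≤ x n) → IsRecursiveSeq x → IsRecursiveSeq fun n => f (x n)
  modulus : ∃ d : ℕ → ℕ → ℕ, Computable₂ d ∧
    ∀ M N : ℕ, ∀ x ∈ Icc (0 : ℝ) M, ∀ y ∈ Icc (0 : ℝ) M,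
      |x - y| ≤ (1 / 2) ^ d M N → |f x - f y| ≤ (1 / 2) ^ N

/-- An order function `ℕ → ℝ`: recursive, nondecreasing and unbounded. -/
structure IsOrderFunction (p : ℕ → ℝ) : Prop where
  recursive : IsRecursiveSeq p
  monotone : Monotone p
  unbounded : ¬ BddAbove (range p)

/-- Fast-growing: the series of reciprocals converges (used for positive `p`). -/
def IsFastGrowing (p : ℕ → ℝ) : Prop :=
  Summable fun n => (p n)⁻¹

/-! Put `g = 1 / pbar`, a nonincreasing function. The integral test bounds tails in both directions:
the sum of `g n` over `n > N` is at most the integral of `g` over `(N, ∞)`, which is at most the sum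
over `n ≥ N`. The partial sums and the partial integrals both form recursive sequences that approach
their limits from below; for the integrals, monotonicity alone bounds the Riemann sum error
(`AntitoneOn.abs_riemann_sum_sub_integral_le`). If the limit of such a sequence is a recursive real,
searching for an index close to the limit yields a recursive modulus of convergence
(`IsRecursiveSeq.exists_modulus`). The tail comparison turns it into a modulus for the other
sequence, whose limit is then recursive (`IsRecursiveSeq.isRecursiveReal_limit_of_tail_le`). -/

section Computability

variable {α : Type*} [Primcodable α]

theorem Computable.nat_add {f g : α → ℕ} (hf : Computable f) (hg : Computable g) :
    Computable fun a => f a + g a :=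
  (Primrec.nat_add.to_comp : Computable₂ _).comp hf hg

theorem Computable.nat_mul {f g : α → ℕ} (hf : Computable f) (hg : Computable g) :
    Computable fun a => f a * g a :=
  (Primrec.nat_mul.to_comp : Computable₂ _).comp hf hg

theorem Computable.nat_div {f g : α → ℕ} (hf : Computable f) (hg : Computable g) :
    Computable fun a => f a / g a :=
  (Primrec.nat_div.to_comp : Computable₂ _).comp hf hg

theorem Computable.nat_mod {f g : α → ℕ} (hf : Computable f) (hg : Computable g) :
    Computable fun a => f a % g a :=
  (Primrec.nat_mod.to_comp : Computable₂ _).comp hf hg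

theorem Computable.nat_pow {f g : α → ℕ} (hf : Computable f) (hg : Computable g) :
    Computable fun a => f a ^ g a :=
  have h : Primrec₂ ((· ^ ·) : ℕ → ℕ → ℕ) := Primrec₂.unpaired'.1 Nat.Primrec.pow
  (h.to_comp : Computable₂ _).comp hf hg

theorem Computable.sum_range {len : α → ℕ} {f : α → ℕ → ℕ} (hlen : Computable len)
    (hf : Computable₂ f) : Computable fun a => ∑ i ∈ Finset.range (len a), f a i := by
  have hstep : Computable₂ fun (a : α) (s : ℕ × ℕ) => s.2 + f a s.1 :=
    ((Computable.snd.comp Computable.snd).nat_add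
      (hf.comp Computable.fst (Computable.fst.comp Computable.snd))).to₂
  refine (Computable.nat_rec hlen (Computable.const 0) hstep).of_eq fun a => ?_
  induction len a with
  | zero => rfl
  | succ n ih => rw [Finset.sum_range_succ, ← ih]

/-- Unbounded search for a natural number witness of a decidable computable relation. -/
theorem Computable.exists_search {r : α → ℕ → Bool} (hr : Computable₂ r)
    (h : ∀ a, ∃ n, r a n = true) : ∃ f : α → ℕ, Computable f ∧ ∀ a, r a (f a) = true := by
  have hdom : ∀ a, (Nat.rfind fun n => Part.some (r a n)).Dom := fun a => by
    obtain ⟨n, hn⟩ := h a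
    obtain ⟨m, hm, -⟩ := Nat.rfind_min' (p := r a) (m := n) hn
    exact Part.dom_iff_mem.2 ⟨m, hm⟩
  refine ⟨fun a => (Nat.rfind fun n => Part.some (r a n)).get (hdom a),
    Partrec.of_eq_tot (Partrec.rfind (p := fun a n => Part.some (r a n)) hr)
      fun a => Part.get_mem _, fun a => ?_⟩
  simpa using Nat.rfind_spec (Part.get_mem (hdom a))

end Computability

/-! ### Recursive reals and effective limits -/

theorem IsRecursiveSeq.of_nat_div {x : ℕ → ℝ} {a b : ℕ → ℕ → ℕ} (ha : Computable₂ a)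
    (hb : Computable₂ b) (hb0 : ∀ n k, b n k ≠ 0)
    (h : ∀ n k, |(a n k : ℝ) / b n k - x n| ≤ (1 / 2) ^ k) : IsRecursiveSeq x := by
  refine ⟨fun p => (a p.1 p.2 : ℚ) / b p.1 p.2, ⟨fun _ => 0, fun p => a p.1 p.2,
    fun p => b p.1 p.2, Computable.const 0, ha, hb, fun p => ⟨hb0 _ _, by simp⟩⟩, fun n k => ?_⟩
  simpa using h n k

theorem IsRecursiveReal.isRecursiveSeq_const {x : ℝ} (hx : IsRecursiveReal x) :
    IsRecursiveSeq fun _ => x := by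
  obtain ⟨q, ⟨s, a, b, hs, ha, hb, hq⟩, h⟩ := hx
  exact ⟨fun p => q p.2, ⟨_, _, _, hs.comp Computable.snd, ha.comp Computable.snd,
    hb.comp Computable.snd, fun i => hq _⟩, fun _ k => h k⟩

/-- A real that is the effective limit of a recursive sequence of reals is recursive. -/
theorem IsRecursiveSeq.isRecursiveReal_of_effective_limit {x : ℕ → ℝ} (hx : IsRecursiveSeq x)
    {y : ℝ} {f : ℕ → ℕ} (hf : Computable f) (h : ∀ k, |x (f k) - y| ≤ (1 / 2) ^ k) :
    IsRecursiveReal y := by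
  obtain ⟨q, ⟨s, a, b, hs, ha, hb, hq⟩, hqx⟩ := hx
  have hg : Computable fun k : ℕ => (f (k + 1), k + 1) :=
    (hf.comp Computable.succ).pair Computable.succ
  refine ⟨fun k => q (f (k + 1), k + 1),
    ⟨_, _, _, hs.comp hg, ha.comp hg, hb.comp hg, fun i => hq _⟩, fun k => ?_⟩
  have h1 := hqx (f (k + 1)) (k + 1)
  have h2 := h (k + 1)
  calc _ ≤ |(q (f (k + 1), k + 1) : ℝ) - x (f (k + 1))| + |x (f (k + 1)) - y| :=
        abs_sub_le _ _ _
    _ ≤ (1 / 2) ^ (k + 1) + (1 / 2) ^ (k + 1) := add_le_add h1 h2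
    _ = _ := by ring

/-- Recursive sequences of nonnegative reals have dyadic natural number approximations. -/
theorem IsRecursiveSeq.exists_dyadic {x : ℕ → ℝ} (hx : IsRecursiveSeq x) (h0 : ∀ n, 0 ≤ x n) :
    ∃ a : ℕ → ℕ → ℕ, Computable₂ a ∧ ∀ n k, |(a n k : ℝ) / 2 ^ k - x n| ≤ (1 / 2) ^ k := by
  obtain ⟨q, ⟨s, a, b, hs, ha, hb, hq⟩, h⟩ := hx
  have hidx : Computable fun p : ℕ × ℕ => (p.1, p.2 + 1) :=
    Computable.fst.pair (Computable.succ.comp Computable.snd)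
  have hpar : Computable fun p : ℕ × ℕ => (s (p.1, p.2 + 1) + 1) % 2 :=
    ((Computable.succ.comp (hs.comp hidx))).nat_mod (Computable.const 2)
  -- rounding to the nearest multiple of `2⁻ᵏ`; negative approximations are replaced by `0`
  refine ⟨fun n k => (s (n, k + 1) + 1) % 2 *
      ((2 ^ (k + 1) * a (n, k + 1) + b (n, k + 1)) / (2 * b (n, k + 1))), ?_, fun n k => ?_⟩
  · exact hpar.nat_mul ((((((Computable.const 2).nat_pow
      (Computable.succ.comp Computable.snd)).nat_mul (ha.comp hidx)).nat_add
      (hb.comp hidx))).nat_div ((Computable.const 2).nat_mul (hb.comp hidx)))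
  beta_reduce
  obtain ⟨hb0, hqe⟩ := hq (n, k + 1)
  have hk := h n (k + 1)
  rw [hqe] at hk
  generalize s (n, k + 1) = s at *
  generalize a (n, k + 1) = a at *
  generalize b (n, k + 1) = b at *
  have hbpos : (0 : ℝ) < b := by exact_mod_cast Nat.pos_of_ne_zero hb0
  have hab : (0 : ℝ) ≤ a / b := by positivity
  have hx0 := h0 n
  rcases Nat.even_or_odd s with hs | hs
  · have hs2 : (s + 1) % 2 = 1 := by have := Nat.even_iff.1 hs; omega
    rw [hs2, one_mul]
    set r := (2 ^ (k + 1) * a + b) / (2 * b) with hr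
    rw [hs.neg_one_pow] at hk
    push_cast at hk
    rw [one_mul] at hk
    have hround : |(r : ℝ) - 2 ^ k * (a / b)| ≤ 1 / 2 := by
      have h1 : r * (2 * b) ≤ 2 ^ (k + 1) * a + b := Nat.div_mul_le_self _ _
      have h2 : 2 ^ (k + 1) * a + b < (r + 1) * (2 * b) := by
        have := Nat.lt_div_mul_add (a := 2 ^ (k + 1) * a + b) (b := 2 * b) (by omega)
        rw [← hr] at this; linarith
      have h1' : (r : ℝ) * (2 * b) ≤ 2 ^ (k + 1) * a + b := by exact_mod_cast h1
      have h2' : (2 : ℝ) ^ (k + 1) * a + b ≤ (r + 1) * (2 * b) := by exact_mod_cast h2.le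
      have he : (2 : ℝ) ^ k * (a / b) = 2 ^ (k + 1) * a / (2 * b) := by
        field_simp; ring
      rw [he, abs_le]
      constructor
      · rw [le_sub_iff_add_le, ← le_sub_iff_add_le', div_le_iff₀ (by positivity)]; linarith
      · rw [sub_le_iff_le_add, ← sub_le_iff_le_add', le_div_iff₀ (by positivity)]; linarith
    have h3 : |(r : ℝ) / 2 ^ k - a / b| ≤ (1 / 2) ^ (k + 1) := by
      have : (r : ℝ) / 2 ^ k - a / b = (r - 2 ^ k * (a / b)) / 2 ^ k := by field_simp
      rw [this, abs_div, abs_of_pos (by positivity : (0 : ℝ) < 2 ^ k), div_le_iff₀ (by positivity)]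
      calc _ ≤ (1 : ℝ) / 2 := hround
        _ = _ := by rw [pow_succ, mul_right_comm, ← mul_pow]; norm_num
    calc _ ≤ |(r : ℝ) / 2 ^ k - a / b| + |a / b - x n| := abs_sub_le _ _ _
      _ ≤ (1 / 2) ^ (k + 1) + (1 / 2) ^ (k + 1) := add_le_add h3 hk
      _ = _ := by ring
  · have hs2 : (s + 1) % 2 = 0 := by have := Nat.odd_iff.1 hs; omega
    rw [hs2, zero_mul]
    rw [hs.neg_one_pow] at hk
    push_cast at hk
    -- The approximation is nonpositive and `x n` nonnegative, so `x n ≤ (1 / 2) ^ (k + 1)` and `0`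
    -- is close enough.
    have h4 := (abs_le.1 hk).1
    have h5 : (1 / 2 : ℝ) ^ (k + 1) ≤ (1 / 2) ^ k := by
      rw [pow_succ]; have : (0 : ℝ) < (1 / 2) ^ k := by positivity
      linarith
    have h6 : (-1 * (a : ℝ)) / b ≤ 0 := by rw [neg_one_mul, neg_div]; linarith
    rw [Nat.cast_zero, zero_div, zero_sub, abs_neg, abs_of_nonneg hx0]
    linarith

/-- In `|1/r - 1/x| = |r - x| / (r x)` the denominator is at least `2⁻⁽²ᶜ⁺¹⁾`, since `r ≥ 2⁻⁽ᶜ⁺¹⁾`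
and `x ≥ 2⁻ᶜ`; hence `2 * c + 1` extra bits suffice. -/
theorem IsRecursiveSeq.inv {x : ℕ → ℝ} (hx : IsRecursiveSeq x) {c : ℕ}
    (hc : ∀ n, (1 / 2) ^ c ≤ x n) : IsRecursiveSeq fun n => (x n)⁻¹ := by
  have hcpos : (0 : ℝ) < (1 / 2) ^ c := by positivity
  obtain ⟨a, ha, h⟩ := hx.exists_dyadic fun n => hcpos.le.trans (hc n)
  have hexp : Computable fun p : ℕ × ℕ => p.2 + (2 * c + 1) :=
    Computable.snd.nat_add (Computable.const _)
  have hlow : ∀ n k, (1 / 2 : ℝ) ^ (c + 1) ≤ a n (k + (2 * c + 1)) / 2 ^ (k + (2 * c + 1)) := by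
    intro n k
    have h1 := (abs_le.1 (h n (k + (2 * c + 1)))).1
    have h2 : (1 / 2 : ℝ) ^ (k + (2 * c + 1)) ≤ (1 / 2) ^ (c + 1) :=
      pow_le_pow_of_le_one (by norm_num) (by norm_num) (by omega)
    have h3 : (1 / 2 : ℝ) ^ c = 2 * (1 / 2) ^ (c + 1) := by ring
    linarith [hc n]
  refine .of_nat_div (a := fun _ k => 2 ^ (k + (2 * c + 1))) (b := fun n k => a n (k + (2 * c + 1)))
    ((Computable.const 2).nat_pow hexp) (ha.comp Computable.fst hexp) (fun n k h0 => ?_)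
    fun n k => ?_
  · have := hlow n k
    rw [h0, Nat.cast_zero, zero_div] at this
    exact absurd this (not_le.2 (by positivity))
  · have h1 := hlow n k
    have h2 := h n (k + (2 * c + 1))
    have h3 := hc n
    push_cast
    rw [← inv_div]
    generalize (a n (k + (2 * c + 1)) : ℝ) / 2 ^ (k + (2 * c + 1)) = r at *
    have hr : 0 < r := lt_of_lt_of_le (by positivity) h1
    have hxn : 0 < x n := hcpos.trans_le h3
    rw [inv_sub_inv hr.ne' hxn.ne', abs_div, abs_of_pos (mul_pos hr hxn),
      div_le_iff₀ (mul_pos hr hxn), abs_sub_comm]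
    calc _ ≤ (1 / 2 : ℝ) ^ (k + (2 * c + 1)) := h2
      _ = (1 / 2) ^ k * ((1 / 2) ^ (c + 1) * (1 / 2) ^ c) := by ring
      _ ≤ _ := by gcongr

/-- A recursive limit of a recursive sequence of nonnegative reals that stays below it is an
effective limit. -/
theorem IsRecursiveSeq.exists_modulus {x : ℕ → ℝ} (hx : IsRecursiveSeq x) (h0 : ∀ n, 0 ≤ x n)
    {y : ℝ} (hy : IsRecursiveReal y) (hle : ∀ n, x n ≤ y)
    (hlim : Tendsto x atTop (nhds y)) :
    ∃ f : ℕ → ℕ, Computable f ∧ ∀ k, y - x (f k) ≤ (1 / 2) ^ k := by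
  obtain ⟨a, ha, hax⟩ := hx.exists_dyadic h0
  obtain ⟨b, hb, hby⟩ := hy.isRecursiveSeq_const.exists_dyadic fun _ => (h0 0).trans (hle 0)
  have hk3 : Computable fun p : ℕ × ℕ => p.1 + 3 := Computable.fst.nat_add (Computable.const 3)
  -- Count in units of `2⁻⁽ᵏ⁺³⁾`; each approximation is off by at most one unit. An `n` with `y - x
  -- n` below one unit passes the test with gap 3, and passing with gap 6 forces `y - x n` to be at
  -- most 8 units, that is `2⁻ᵏ`.
  have hr : Computable₂ fun k n => decide (b 0 (k + 3) ≤ a n (k + 3) + 6) := by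
    have hle : Computable₂ fun m n : ℕ => decide (m ≤ n) := Primrec.nat_le.decide.to_comp
    exact hle.comp (hb.comp (Computable.const 0) hk3)
      ((ha.comp Computable.snd hk3).nat_add (Computable.const 6))
  have key : ∀ k n, (2 : ℝ) ^ k * (a n k / 2 ^ k) = a n k ∧ (2 : ℝ) ^ k * (b 0 k / 2 ^ k) = b 0 k ∧
      (2 : ℝ) ^ k * (1 / 2) ^ k = 1 := fun k n =>
    ⟨by field_simp, by field_simp, by rw [← mul_pow]; norm_num⟩
  obtain ⟨f, hf, hfr⟩ := Computable.exists_search hr fun k => by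
    obtain ⟨n, hn⟩ := (hlim.eventually (eventually_gt_nhds
      (show y - (1 / 2) ^ (k + 3) < y by linarith [show (0 : ℝ) < (1 / 2) ^ (k + 3) by positivity])
      )).exists
    refine ⟨n, decide_eq_true ?_⟩
    have h1 := (abs_le.1 (hby 0 (k + 3))).2
    have h2 := (abs_le.1 (hax n (k + 3))).1
    have h3 : (b 0 (k + 3) : ℝ) / 2 ^ (k + 3) ≤
      a n (k + 3) / 2 ^ (k + 3) + 3 * (1 / 2) ^ (k + 3) := by linarith
    have h4 := mul_le_mul_of_nonneg_left h3 (show (0 : ℝ) ≤ 2 ^ (k + 3) by positivity)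
    obtain ⟨e1, e2, e3⟩ := key (k + 3) n
    have h5 : (b 0 (k + 3) : ℝ) ≤ a n (k + 3) + 3 := by
      rw [mul_add, e1, e2, mul_left_comm, e3] at h4; linarith
    have h6 : b 0 (k + 3) ≤ a n (k + 3) + 3 := by exact_mod_cast h5
    omega
  refine ⟨f, hf, fun k => ?_⟩
  have h1 := (abs_le.1 (hby 0 (k + 3))).1
  have h2 := (abs_le.1 (hax (f k) (k + 3))).2
  have h3 : (b 0 (k + 3) : ℝ) ≤ a (f k) (k + 3) + 6 := by
    exact_mod_cast of_decide_eq_true (hfr k)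
  have h4 := div_le_div_of_nonneg_right h3 (show (0 : ℝ) ≤ 2 ^ (k + 3) by positivity)
  have h5 : (6 : ℝ) / 2 ^ (k + 3) = 6 * (1 / 2) ^ (k + 3) := by rw [one_div, inv_pow]; rfl
  rw [add_div, h5] at h4
  calc _ ≤ 8 * (1 / 2 : ℝ) ^ (k + 3) := by linarith
    _ = _ := by ring

/-! ### Riemann sums -/

/-- If uniformly spaced Riemann sums of `g` over `[0, N]`, taken at a computable dyadic level,
approximate `x N` with the required precision, then `x` is a recursive sequence. -/
theorem IsRecursiveSeq.of_dyadic_riemann_sum {g : ℝ → ℝ}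
    (hg : IsRecursiveSeq fun j => g ((j.unpair.2 : ℝ) / 2 ^ j.unpair.1))
    (hg0 : ∀ t, 0 ≤ t → 0 ≤ g t) {x : ℕ → ℝ} {s : ℕ → ℕ} (hs : Computable s)
    (h : ∀ N k, |(∑ i ∈ Finset.range (N * 2 ^ s k), g ((i : ℝ) / 2 ^ s k)) / 2 ^ s k - x N|
      ≤ (1 / 2) ^ (k + 1)) : IsRecursiveSeq x := by
  obtain ⟨a, ha, hax⟩ := hg.exists_dyadic fun j => hg0 _ (by positivity)
  have hsk : Computable fun p : ℕ × ℕ => s p.2 := hs.comp Computable.snd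
  -- The sum has `N * 2 ^ s k` terms and is divided by `2 ^ s k`, so term errors are amplified by
  -- `N`; `N` extra bits absorb this because `N ≤ 2 ^ N`.
  have hprec : Computable fun p : ℕ × ℕ => p.2 + 1 + p.1 :=
    (Computable.succ.comp Computable.snd).nat_add Computable.fst
  have hterm : Computable₂ fun (p : ℕ × ℕ) (i : ℕ) => a (Nat.pair (s p.2) i) (p.2 + 1 + p.1) :=
    ha.comp ((Primrec₂.natPair.to_comp : Computable₂ _).comp (hsk.comp Computable.fst)
      Computable.snd) (hprec.comp Computable.fst)
  refine .of_nat_div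
    (a := fun N k => ∑ i ∈ Finset.range (N * 2 ^ s k), a (Nat.pair (s k) i) (k + 1 + N))
    (b := fun N k => 2 ^ (k + 1 + N) * 2 ^ s k)
    (Computable.sum_range (Computable.fst.nat_mul ((Computable.const 2).nat_pow hsk)) hterm)
    (((Computable.const 2).nat_pow hprec).nat_mul ((Computable.const 2).nat_pow hsk))
    (fun N k => by positivity) fun N k => ?_
  have hsum : |(∑ i ∈ Finset.range (N * 2 ^ s k), (a (Nat.pair (s k) i) (k + 1 + N) : ℝ)) /
      (2 ^ (k + 1 + N) * 2 ^ s k) -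
      (∑ i ∈ Finset.range (N * 2 ^ s k), g ((i : ℝ) / 2 ^ s k)) / 2 ^ s k| ≤
      (1 / 2) ^ (k + 1) := by
    rw [← div_div, Finset.sum_div, ← sub_div, ← Finset.sum_sub_distrib, abs_div,
      abs_of_pos (by positivity : (0 : ℝ) < 2 ^ s k), div_le_iff₀ (by positivity)]
    calc _ ≤ ∑ i ∈ Finset.range (N * 2 ^ s k), |(a (Nat.pair (s k) i) (k + 1 + N) : ℝ) /
          2 ^ (k + 1 + N) - g ((i : ℝ) / 2 ^ s k)| := Finset.abs_sum_le_sum_abs _ _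
      _ ≤ ∑ i ∈ Finset.range (N * 2 ^ s k), (1 / 2 : ℝ) ^ (k + 1 + N) :=
        Finset.sum_le_sum fun i _ => by simpa using hax (Nat.pair (s k) i) (k + 1 + N)
      _ = (1 / 2 : ℝ) ^ (k + 1) * 2 ^ s k * (N * (1 / 2) ^ N) := by
        rw [Finset.sum_const, Finset.card_range, nsmul_eq_mul]; push_cast; ring
      _ ≤ (1 / 2 : ℝ) ^ (k + 1) * 2 ^ s k * 1 := by
        gcongr
        rw [one_div, inv_pow, ← div_eq_mul_inv, div_le_one (by positivity)]
        exact_mod_cast Nat.lt_two_pow_self.le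
      _ = _ := mul_one _
  push_cast
  calc _ ≤ _ := abs_sub_le _ ((∑ i ∈ Finset.range (N * 2 ^ s k), g ((i : ℝ) / 2 ^ s k)) / 2 ^ s k) _
    _ ≤ (1 / 2) ^ (k + 1) + (1 / 2) ^ (k + 1) := add_le_add hsum (h N k)
    _ = _ := by ring

/-- The integral lies between the right and left sums, whose difference telescopes to `(g 0 - g N) /
M`. -/
theorem AntitoneOn.abs_riemann_sum_sub_integral_le {g : ℝ → ℝ} (hg : AntitoneOn g (Ici 0))
    (hg0 : ∀ t, 0 ≤ t → 0 ≤ g t) (N : ℕ) {M : ℕ} (hM : 0 < M) :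
    |(∑ i ∈ Finset.range (N * M), g ((i : ℝ) / M)) / M - ∫ t in (0 : ℝ)..N, g t| ≤ g 0 / M := by
  have hM' : (0 : ℝ) < M := Nat.cast_pos.2 hM
  have hanti : AntitoneOn (fun t : ℝ => g (t / M)) (Icc (0 : ℝ) (0 + (N * M : ℕ))) := by
    intro a ha b hb hab
    exact hg (div_nonneg ha.1 hM'.le) (div_nonneg hb.1 hM'.le) (by gcongr)
  have hint : ∫ t in (0 : ℝ)..(0 + (N * M : ℕ)), g (t / M) = M * ∫ t in (0 : ℝ)..N, g t := by
    rw [intervalIntegral.integral_comp_div _ hM'.ne', smul_eq_mul]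
    congr 2
    · simp
    · push_cast; field_simp; simp
  have h1 := hanti.integral_le_sum
  have h2 := hanti.sum_le_integral
  rw [hint] at h1 h2
  simp only [zero_add] at h1 h2
  have h3 := Finset.sum_range_succ (fun i : ℕ => g ((i : ℝ) / M)) (N * M)
  rw [Finset.sum_range_succ' (fun i : ℕ => g ((i : ℝ) / M))] at h3
  have h4 : 0 ≤ g (((N * M : ℕ) : ℝ) / M) := hg0 _ (by positivity)
  simp only [Nat.cast_zero, zero_div] at h3
  have h5 : (∑ i ∈ Finset.range (N * M), g ((i : ℝ) / M)) / M - ∫ t in (0 : ℝ)..N, g t =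
      (∑ i ∈ Finset.range (N * M), g ((i : ℝ) / M) - M * ∫ t in (0 : ℝ)..N, g t) / M := by
    field_simp
  rw [h5, abs_div, abs_of_pos hM', abs_of_nonneg (by linarith)]
  gcongr
  linarith

/-- Enumerating all points `i / 2 ^ s` by one index lets a recursive function be evaluated uniformly
on every dyadic grid. -/
theorem isRecursiveSeq_dyadic_points :
    IsRecursiveSeq fun j => (j.unpair.2 : ℝ) / 2 ^ j.unpair.1 := by
  have hu : Computable fun p : ℕ × ℕ => p.1.unpair := Primrec.unpair.to_comp.comp Computable.fst
  refine .of_nat_div (a := fun j _ => j.unpair.2) (b := fun j _ => 2 ^ j.unpair.1)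
    (Computable.snd.comp hu) ((Computable.const 2).nat_pow (Computable.fst.comp hu))
    (fun _ _ => by positivity) fun _ _ => ?_
  simp

/-- If the tails of `u` are dominated by the (possibly shifted) tails of `v`, a recursive limit of
`v` forces a recursive limit of `u`. -/
theorem IsRecursiveSeq.isRecursiveReal_limit_of_tail_le {u v : ℕ → ℝ} (hu : IsRecursiveSeq u)
    (hv : IsRecursiveSeq v) (hv0 : ∀ n, 0 ≤ v n) {y z : ℝ} (huy : ∀ n, u n ≤ y)
    (hvz : ∀ n, v n ≤ z) (hlim : Tendsto v atTop (nhds z)) {f : ℕ → ℕ} (hf : Computable f)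
    (htail : ∀ n, y - u (f n) ≤ z - v n) (hz : IsRecursiveReal z) : IsRecursiveReal y := by
  obtain ⟨m, hm, hmk⟩ := hv.exists_modulus hv0 hz hvz hlim
  refine hu.isRecursiveReal_of_effective_limit (hf.comp hm) fun k => ?_
  rw [abs_sub_comm, abs_of_nonneg (sub_nonneg.2 (huy _))]
  exact (htail _).trans (hmk k)

/-! ### The sum and the integral -/

theorem mainTheorem1
    (p : ℕ → ℝ) (hpos : ∀ n, 0 < p n) (hord : IsOrderFunction p) (hfast : IsFastGrowing p)
    (pbar : ℝ → ℝ) (hbar_pos : ∀ x ∈ Ici (0 : ℝ), 0 < pbar x)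
    (hbar_cont : ContinuousOn pbar (Ici 0)) (hbar_rec : IsRecursiveFunOnNonneg pbar)
    (hbar_mono : MonotoneOn pbar (Ici 0)) (hbar_ext : ∀ n : ℕ, pbar (n : ℝ) = p n) :
    IntegrableOn (fun x => (pbar x)⁻¹) (Ioi 0) ∧
      (IsRecursiveReal (∑' n, (p n)⁻¹) ↔
        IsRecursiveReal (∫ x in Ioi (0 : ℝ), (pbar x)⁻¹)) := by
  set g : ℝ → ℝ := fun x => (pbar x)⁻¹ with hgdef
  have hgn : ∀ n : ℕ, (p n)⁻¹ = g n := fun n => by rw [hgdef, ← hbar_ext]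
  have hg0 : ∀ t, 0 ≤ t → 0 ≤ g t := fun t ht => (inv_pos.2 (hbar_pos t ht)).le
  have hanti : AntitoneOn g (Ici 0) := fun a ha b hb hab =>
    inv_anti₀ (hbar_pos a ha) (hbar_mono ha hb hab)
  have hsum : Summable fun n : ℕ => g n := by simpa only [IsFastGrowing, hgn] using hfast
  have hint : IntegrableOn g (Ioi 0) :=
    hanti.integrableOn_Ioi_zero_of_summable hsum fun t ht => hg0 t (le_of_lt ht)
  refine ⟨hint, ?_⟩
  simp only [hgn]
  -- Since `pbar` is nondecreasing, `2⁻ᶜ` bounds it below everywhere, and `g ≤ 2 ^ c`.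
  obtain ⟨c, hc⟩ := exists_pow_lt_of_lt_one (hbar_pos 0 self_mem_Ici) (by norm_num : (1 / 2 : ℝ) < 1)
  have hgrec : IsRecursiveSeq fun j => g ((j.unpair.2 : ℝ) / 2 ^ j.unpair.1) := by
    have h0 : ∀ j : ℕ, (0 : ℝ) ≤ (j.unpair.2 : ℝ) / 2 ^ j.unpair.1 := fun j => by positivity
    exact (hbar_rec.seq _ h0 isRecursiveSeq_dyadic_points).inv (c := c) fun j =>
      hc.le.trans (hbar_mono self_mem_Ici (h0 j) (h0 j))
  have hA : IsRecursiveSeq fun N => ∑ i ∈ Finset.range N, g i := by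
    -- At mesh 1 the Riemann sum is the partial sum itself.
    refine .of_dyadic_riemann_sum hgrec hg0 (Computable.const 0) fun N k => ?_
    simp
  have hB : IsRecursiveSeq fun N : ℕ => ∫ t in (0 : ℝ)..N, g t := by
    refine .of_dyadic_riemann_sum hgrec hg0 (s := fun k => k + 1 + c)
      ((Computable.nat_add Computable.succ (Computable.const c))) fun N k => ?_
    have h := hanti.abs_riemann_sum_sub_integral_le hg0 N (M := 2 ^ (k + 1 + c)) (by positivity)
    push_cast at h
    refine h.trans ?_
    have hgc : g 0 ≤ 2 ^ c := by
      have := inv_anti₀ (by positivity) hc.le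
      simpa using this
    rw [div_le_iff₀ (by positivity)]
    calc g 0 ≤ 2 ^ c := hgc
      _ = ((1 / 2) * 2) ^ (k + 1) * 2 ^ c := by norm_num
      _ = _ := by rw [mul_pow, pow_add 2 (k + 1) c, mul_assoc]
  have hBlim : Tendsto (fun N : ℕ => ∫ t in (0 : ℝ)..N, g t) atTop
      (nhds (∫ t in Ioi (0 : ℝ), g t)) :=
    intervalIntegral_tendsto_integral_Ioi 0 hint tendsto_natCast_atTop_atTop
  have hanti' : ∀ N : ℕ, AntitoneOn g (Ici (N : ℝ)) := fun N =>
    hanti.mono (Ici_subset_Ici.2 N.cast_nonneg)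
  have hg0' : ∀ N : ℕ, ∀ t ∈ Ioi (N : ℝ), 0 ≤ g t := fun N t ht =>
    hg0 t (N.cast_nonneg.trans (le_of_lt ht))
  have hint' : ∀ N : ℕ, IntegrableOn g (Ioi (N : ℝ)) := fun N =>
    hint.mono_set (Ioi_subset_Ioi N.cast_nonneg)
  have htailB : ∀ N : ℕ, (∫ t in Ioi (0 : ℝ), g t) - ∫ t in (0 : ℝ)..N, g t =
      ∫ t in Ioi (N : ℝ), g t := fun N => by
    rw [← intervalIntegral.integral_Ioi_sub_Ioi hint (N.cast_nonneg), sub_sub_cancel]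
  have htailA : ∀ N : ℕ, (∑' n : ℕ, g n) - ∑ i ∈ Finset.range N, g i = ∑' n : ℕ, g (n + N : ℕ) :=
    fun N => by rw [← hsum.sum_add_tsum_nat_add N, add_sub_cancel_left]
  have hAle : ∀ N : ℕ, ∑ i ∈ Finset.range N, g i ≤ ∑' n : ℕ, g n := fun N =>
    hsum.sum_le_tsum _ fun i _ => hg0 _ i.cast_nonneg
  have hBle : ∀ N : ℕ, ∫ t in (0 : ℝ)..N, g t ≤ ∫ t in Ioi (0 : ℝ), g t := fun N => by
    rw [← sub_nonneg, htailB]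
    exact setIntegral_nonneg measurableSet_Ioi (hg0' N)
  constructor
  · refine hB.isRecursiveReal_limit_of_tail_le hA
      (fun N => Finset.sum_nonneg fun i _ => hg0 _ i.cast_nonneg) hBle hAle
      hsum.tendsto_sum_tsum_nat Computable.id fun N => ?_
    rw [id, htailB, htailA]
    exact (hanti' N).integral_le_tsum_comp_add N hsum (hg0' N)
  -- The shift by `Computable.succ` is needed: the integral beyond `N` dominates only the terms from
  -- `N + 1` on.
  · refine hA.isRecursiveReal_limit_of_tail_le hB
      (fun N => intervalIntegral.integral_nonneg N.cast_nonneg fun t ht => hg0 t ht.1) hAle hBle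
      hBlim Computable.succ fun N => ?_
    rw [htailB, htailA]
    exact (hanti' N).tsum_comp_add_le_integral N (hint' N) (hg0' N)
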